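/- Smoothness is understood in the sense of Michal--Bastiani: a map between open subsets of Hausdorff locally convex spaces is smooth if all its iterated directional derivatives exist and are jointly continuous. Locally convex manifolds are Hausdorff manifolds modelled on a Hausdorff locally convex space with smooth chart changes; locally convex Lie groups are groups that are such manifolds with smooth multiplication and inversion. Let $G$ be a (real) locally convex Lie group with Lie algebra $\mathfrak{g} = T_{\mathbf 1}G$, the bracket being that of left invariant vector fields. Let $\mathcal{M}$ be a locally convex manifold with a symplectic form $\Omega$, i.e. a smooth closed $2$-form that is weakly nondegenerate ($\Omega_m(v,w)=0$ for all $w \in T_m\mathcal{M}$ implies $v=0$). Let $\alpha \colon G\times\mathcal{M}\to\mathcal{M}$ be a symplectic action, i.e. an action such that every orbit map $G \to \mathcal{M}$, $g\mapsto\alpha_g(m)$, and every map $\alpha_g\colon\mathcal{M}\to\mathcal{M}$ is smooth, and $\alpha_g^*\Omega=\Omega$ for all $g\in G$ (the action map is not assumed to be jointly smooth). For $\xi\in\mathfrak{g}$, let $X_\xi(m)\in T_m\mathcal{M}$ be the derivative at $\mathbf 1$ in the direction $\xi$ of the orbit map $g\mapsto\alpha_g(m)$. Then for every $m\in\mathcal{M}$,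 the map \[\omega_m\colon\mathfrak{g}\times\mathfrak{g}\to\mathbb{R},\qquad \omega_m(\xi,\eta)=\Omega_m(X_\xi(m),X_\eta(m)),\] is a continuous Lie algebra $2$-cocycle: it is jointly continuous, bilinear and alternating, and \[\omega_m([\xi,\eta],\zeta)+\omega_m([\eta,\zeta],\xi)+\omega_m([\zeta,\xi],\eta)=0\qquad(\xi,\eta,\zeta\in\mathfrak{g}).\] If moreover $(\mathcal{M},\Omega)$ is a Kähler manifold, i.e. $\mathcal{M}$ is a complex manifold modelled on a complex locally convex space and $\Omega=\mathrm{Im}\,H$ for a smooth positive definite Hermitian form $H$ on the tangent spaces (antilinear in the first and linear in the second argument), then for every $m \in \mathcal{M}$ there is a continuous, positive semidefinite Hermitian form $h_m\colon\mathfrak{g}_{\mathbb{C}}\times\mathfrak{g}_{\mathbb{C}}\to\mathbb{C}$ (antilinear in the first and linear in the second argument) such that $\omega_m(\xi,\eta)=\mathrm{Im}\,h_m(\xi,\eta)$ for all $\xi,\eta\in\mathfrak{g}$. -/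

import Mathlib

open Set Filter Topology
open scoped ComplexConjugate

noncomputable section

/-! ### Michal--Bastiani calculus in topological vector spaces -/

section Calculus

variable (𝕜 : Type*) [NontriviallyNormedField 𝕜]
  {E : Type*} [AddCommGroup E] [Module 𝕜 E]
  {F : Type*} [AddCommGroup F] [Module 𝕜 F] [TopologicalSpace F]

/-- `w` is the derivative of `f` at `x` in the direction `v`. -/
def HasDirDeriv (f : E → F) (x v : E) (w : F) : Prop :=
  Tendsto (fun t : 𝕜 => t⁻¹ • (f (x + t • v) - f x)) (𝓝[≠] 0) (𝓝 w)

open Classical in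
/-- The derivative of `f` at `x` in the direction `v` (zero if it does not exist). -/
def dirDeriv (f : E → F) (x v : E) : F :=
  if h : ∃ w, HasDirDeriv 𝕜 f x v w then h.choose else 0

/-- The iterated directional derivative
`d^k f (x; v₀, …, v_{k-1}) = (D_{v_{k-1}} ⋯ D_{v₀} f)(x)`. -/
def iterDirDeriv (f : E → F) : (k : ℕ) → E → (Fin k → E) → F
  | 0, x, _ => f x
  | k + 1, x, v =>
      dirDeriv 𝕜 (fun y => iterDirDeriv f k y (Fin.init v)) x (v (Fin.last k))

/-- `f` is smooth on the open set `U` in the sense of Michal--Bastiani: all iterated directional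
derivatives exist on `U`, and each `d^k f : U × E^k → F` is (jointly) continuous.
For `𝕜 = ℂ` this is holomorphy. -/
def MBSmoothOn [TopologicalSpace E] (f : E → F) (U : Set E) : Prop :=
  ∀ k : ℕ,
    (∀ x ∈ U, ∀ v : Fin (k + 1) → E, ∃ w,
      HasDirDeriv 𝕜 (fun y => iterDirDeriv 𝕜 f k y (Fin.init v)) x (v (Fin.last k)) w) ∧
    ContinuousOn (fun p : E × (Fin k → E) => iterDirDeriv 𝕜 f k p.1 p.2) (U ×ˢ univ)

end Calculus

/-! ### Manifolds modelled on a topological vector space -/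

section Manifolds

variable (𝕜 : Type*) [NontriviallyNormedField 𝕜]
  (E : Type*) [AddCommGroup E] [Module 𝕜 E] [TopologicalSpace E]
  (F : Type*) [AddCommGroup F] [Module 𝕜 F] [TopologicalSpace F]
  {M : Type*} [TopologicalSpace M] [ChartedSpace E M]
  {N : Type*} [TopologicalSpace N] [ChartedSpace F N]

/-- The atlas of `M` makes it a (Hausdorff) manifold modelled on `E`: all chart changes are smooth.
For `𝕜 = ℂ` this is a complex manifold, with a holomorphic atlas. -/
structure IsLCManifold (M : Type*) [TopologicalSpace M] [ChartedSpace E M] : Prop where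
  t2 : T2Space M
  smooth_transition : ∀ e ∈ atlas E M, ∀ e' ∈ atlas E M,
    MBSmoothOn 𝕜 (fun x => e' (e.symm x)) (e.target ∩ e.symm ⁻¹' e'.source)

/-- Smooth maps between manifolds: continuous, and smooth in all charts. -/
def LCSmooth (f : M → N) : Prop :=
  Continuous f ∧ ∀ e ∈ atlas E M, ∀ e' ∈ atlas F N,
    MBSmoothOn 𝕜 (fun x => e' (f (e.symm x)))
      (e.target ∩ e.symm ⁻¹' (f ⁻¹' e'.source))

/-- The tangent space `T_m M`, identified with the model space by the preferred chart at `m`. -/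
abbrev LCTangent (_m : M) : Type _ := E

variable {E F}

/-- The tangent map `T_p f : T_p M → T_q N` of a map `f` with `f p = q`. -/
def lcTangentMap (f : M → N) {p : M} {q : N} (_h : f p = q) (v : LCTangent E p) :
    LCTangent F q :=
  dirDeriv 𝕜 (fun x => chartAt F q (f ((chartAt E p).symm x))) (chartAt E p p) v

/-- The tangent vector at `e.symm x` whose coordinate in the chart `e` is `u`. -/
def tangentOfCoord (e : OpenPartialHomeomorph M E) (x u : E) : LCTangent E (e.symm x) :=
  dirDeriv 𝕜 (fun y => chartAt E (e.symm x) (e.symm y)) x u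

/-- The expression of a vector field in the chart `e`. -/
def fieldInChart (e : OpenPartialHomeomorph M E) (X : (m : M) → LCTangent E m) (x : E) : E :=
  dirDeriv 𝕜 (fun y => e ((chartAt E (e.symm x)).symm y))
    (chartAt E (e.symm x) (e.symm x)) (X (e.symm x))

/-- The Lie bracket `[X, Y] = DY(X) - DX(Y)` of vector fields, computed in the preferred chart
at each point. -/
def fieldBracket (X Y : (m : M) → LCTangent E m) (m : M) : LCTangent E m :=
  dirDeriv 𝕜 (fieldInChart 𝕜 (chartAt E m) Y) (chartAt E m m) (X m)
    - dirDeriv 𝕜 (fieldInChart 𝕜 (chartAt E m) X) (chartAt E m m) (Y m)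

end Manifolds

/-! ### Locally convex Lie groups and their Lie algebra -/

section LieGroups

variable (𝔤 : Type*) [AddCommGroup 𝔤] [Module ℝ 𝔤] [TopologicalSpace 𝔤]
  (G : Type*) [TopologicalSpace G] [ChartedSpace 𝔤 G] [Group G]

/-- Lie groups modelled on `𝔤`: manifolds whose multiplication `G × G → G` and inversion are
smooth.  The charts of `G × G` are the products of charts of `G`. -/
structure IsLCLieGroup : Prop where
  manifold : IsLCManifold ℝ 𝔤 G
  continuous_mul : Continuous (fun p : G × G => p.1 * p.2)
  smooth_mul : ∀ e₁ ∈ atlas 𝔤 G, ∀ e₂ ∈ atlas 𝔤 G, ∀ e₃ ∈ atlas 𝔤 G,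
    MBSmoothOn ℝ (fun p : 𝔤 × 𝔤 => e₃ (e₁.symm p.1 * e₂.symm p.2))
      {p | p.1 ∈ e₁.target ∧ p.2 ∈ e₂.target ∧ e₁.symm p.1 * e₂.symm p.2 ∈ e₃.source}
  smooth_inv : LCSmooth ℝ 𝔤 𝔤 (fun g : G => g⁻¹)

variable {𝔤}

/-- The left invariant vector field on `G` with value `ξ` at the identity. -/
def leftInvariantField (ξ : LCTangent 𝔤 (1 : G)) (g : G) : LCTangent 𝔤 g :=
  lcTangentMap ℝ (fun h : G => g * h) (mul_one g) ξ

/-- The Lie bracket on the Lie algebra `T_1 G` of `G`: the value at the identity of the bracket of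
the left invariant vector fields. -/
def lieAlgBracket (ξ η : LCTangent 𝔤 (1 : G)) : LCTangent 𝔤 (1 : G) :=
  fieldBracket ℝ (leftInvariantField G ξ) (leftInvariantField G η) 1

end LieGroups

/-- Continuous real-valued 2-cocycles for a bracket `br` on a topological vector space: continuous
alternating bilinear maps that satisfy the cocycle identity. -/
structure IsContinuousTwoCocycle {V : Type*} [AddCommGroup V] [Module ℝ V] [TopologicalSpace V]
    (br : V → V → V) (ω : V → V → ℝ) : Prop where
  linear_left : ∀ η, IsLinearMap ℝ (fun ξ => ω ξ η)
  linear_right : ∀ ξ, IsLinearMap ℝ (fun η => ω ξ η)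
  alternating : ∀ ξ, ω ξ ξ = 0
  continuous : Continuous (fun p : V × V => ω p.1 p.2)
  cocycle : ∀ ξ η ζ, ω (br ξ η) ζ + ω (br η ζ) ξ + ω (br ζ ξ) η = 0

/-! ### Symplectic forms and symplectic actions -/

section Symplectic

variable {E : Type*} [AddCommGroup E] [Module ℝ E] [TopologicalSpace E]
  {M : Type*} [TopologicalSpace M] [ChartedSpace E M]

/-- The expression in the chart `e` of a field of (real) bilinear or sesquilinear forms `B` on the
tangent spaces. -/
def formInChart {R : Type*} (B : (m : M) → LCTangent E m → LCTangent E m → R)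
    (e : OpenPartialHomeomorph M E) (x u v : E) : R :=
  B (e.symm x) (tangentOfCoord ℝ e x u) (tangentOfCoord ℝ e x v)

/-- Symplectic forms: smooth 2-forms that are closed and (weakly) nondegenerate. -/
structure IsSymplecticForm
    (Ω : (m : M) → LCTangent E m →ₗ[ℝ] LCTangent E m →ₗ[ℝ] ℝ) : Prop where
  alternating : ∀ m v, Ω m v v = 0
  smooth : ∀ e ∈ atlas E M,
    MBSmoothOn ℝ (fun p : E × E × E => formInChart (fun m u v => Ω m u v) e p.1 p.2.1 p.2.2)
      (e.target ×ˢ univ)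
  closed : ∀ e ∈ atlas E M, ∀ x ∈ e.target, ∀ u v w : E,
    dirDeriv ℝ (fun y => formInChart (fun m u v => Ω m u v) e y v w) x u
      + dirDeriv ℝ (fun y => formInChart (fun m u v => Ω m u v) e y w u) x v
      + dirDeriv ℝ (fun y => formInChart (fun m u v => Ω m u v) e y u v) x w = 0
  nondegenerate : ∀ m v, (∀ w, Ω m v w = 0) → v = 0

/-- Symplectic actions: separately smooth actions by maps that preserve `Ω`. -/
structure IsSymplecticAction (𝔤 : Type*) [AddCommGroup 𝔤] [Module ℝ 𝔤] [TopologicalSpace 𝔤]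
    (G : Type*) [TopologicalSpace G] [ChartedSpace 𝔤 G] [Group G] [MulAction G M]
    (Ω : (m : M) → LCTangent E m →ₗ[ℝ] LCTangent E m →ₗ[ℝ] ℝ) : Prop where
  smooth_orbitMap : ∀ m : M, LCSmooth ℝ 𝔤 E (fun g : G => g • m)
  smooth_smul : ∀ g : G, LCSmooth ℝ E E (fun m : M => g • m)
  preserves : ∀ (g : G) (m : M) (u v : LCTangent E m),
    Ω (g • m) (lcTangentMap ℝ (fun m' : M => g • m') rfl u)
      (lcTangentMap ℝ (fun m' : M => g • m') rfl v) = Ω m u v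

variable {𝔤 : Type*} [AddCommGroup 𝔤] [Module ℝ 𝔤] [TopologicalSpace 𝔤]
  {G : Type*} [TopologicalSpace G] [ChartedSpace 𝔤 G] [Group G] [MulAction G M]

/-- The fundamental vector field `X_ξ`: at `m`, the derivative at the identity in the direction `ξ`
of the orbit map `g ↦ g • m`. -/
def fundamentalField (ξ : LCTangent 𝔤 (1 : G)) (m : M) : LCTangent E m :=
  lcTangentMap ℝ (fun g : G => g • m) (one_smul G m) ξ

variable (G) in
/-- The form `ω_m(ξ, η) = Ω_m(X_ξ, X_η)` on the Lie algebra of `G`. -/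
def kostantSouriau (Ω : (m : M) → LCTangent E m →ₗ[ℝ] LCTangent E m →ₗ[ℝ] ℝ) (m : M)
    (ξ η : LCTangent 𝔤 (1 : G)) : ℝ :=
  Ω m (fundamentalField ξ m) (fundamentalField η m)

end Symplectic

/-! ### Kähler manifolds -/

/-- `(M, Ω)` is a Kähler manifold: `M` is a complex manifold, and the symplectic form `Ω` is the
imaginary part of a smooth positive definite Hermitian form `H` on the tangent spaces
(antilinear in the first variable and linear in the second). -/
def IsKahler {E : Type*} [AddCommGroup E] [Module ℝ E] [Module ℂ E] [TopologicalSpace E]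
    {M : Type*} [TopologicalSpace M] [ChartedSpace E M]
    (Ω : (m : M) → LCTangent E m →ₗ[ℝ] LCTangent E m →ₗ[ℝ] ℝ) : Prop :=
  IsLCManifold ℂ E M ∧ IsSymplecticForm Ω ∧
  ∃ H : (m : M) → LCTangent E m →ₗ⋆[ℂ] LCTangent E m →ₗ[ℂ] ℂ,
    (∀ e ∈ atlas E M,
      MBSmoothOn ℝ (fun p : E × E × E => formInChart (fun m u v => H m u v) e p.1 p.2.1 p.2.2)
        (e.target ×ˢ univ)) ∧
    (∀ m u v, H m v u = conj (H m u v)) ∧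
    (∀ m v, v ≠ 0 → 0 < (H m v v).re) ∧
    (∀ m u v, Ω m u v = (H m u v).im)

/-! ### Complexification -/

/-- The complexification `V_ℂ` of a real topological vector space: the pair `(v, w)` stands for
`v + i w`, and the topology is that of `V × V`. -/
def Complexified (V : Type*) : Type _ := V × V

namespace Complexified

variable {V : Type*}

instance [AddCommGroup V] : AddCommGroup (Complexified V) :=
  inferInstanceAs (AddCommGroup (V × V))

instance [TopologicalSpace V] : TopologicalSpace (Complexified V) :=
  inferInstanceAs (TopologicalSpace (V × V))

instance [AddCommGroup V] [Module ℝ V] : Module ℂ (Complexified V) where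
  smul z p := (z.re • p.1 - z.im • p.2, z.re • p.2 + z.im • p.1)
  one_smul p := by
    refine Prod.ext ?_ ?_
    · change (1 : ℂ).re • p.1 - (1 : ℂ).im • p.2 = p.1
      simp
    · change (1 : ℂ).re • p.2 + (1 : ℂ).im • p.1 = p.2
      simp
  mul_smul z w p := by
    refine Prod.ext ?_ ?_
    · change (z * w).re • p.1 - (z * w).im • p.2 =
        z.re • (w.re • p.1 - w.im • p.2) - z.im • (w.re • p.2 + w.im • p.1)
      rw [Complex.mul_re, Complex.mul_im]
      module
    · change (z * w).re • p.2 + (z * w).im • p.1 =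
        z.re • (w.re • p.2 + w.im • p.1) + z.im • (w.re • p.1 - w.im • p.2)
      rw [Complex.mul_re, Complex.mul_im]
      module
  smul_zero z := by
    refine Prod.ext ?_ ?_
    · change z.re • (0 : V) - z.im • (0 : V) = 0
      simp
    · change z.re • (0 : V) + z.im • (0 : V) = 0
      simp
  smul_add z p q := by
    refine Prod.ext ?_ ?_
    · change z.re • (p.1 + q.1) - z.im • (p.2 + q.2) =
        (z.re • p.1 - z.im • p.2) + (z.re • q.1 - z.im • q.2)
      module
    · change z.re • (p.2 + q.2) + z.im • (p.1 + q.1) =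
        (z.re • p.2 + z.im • p.1) + (z.re • q.2 + z.im • q.1)
      module
  add_smul z w p := by
    refine Prod.ext ?_ ?_
    · change (z + w).re • p.1 - (z + w).im • p.2 =
        (z.re • p.1 - z.im • p.2) + (w.re • p.1 - w.im • p.2)
      rw [Complex.add_re, Complex.add_im]
      module
    · change (z + w).re • p.2 + (z + w).im • p.1 =
        (z.re • p.2 + z.im • p.1) + (w.re • p.2 + w.im • p.1)
      rw [Complex.add_re, Complex.add_im]
      module
  zero_smul p := by
    refine Prod.ext ?_ ?_
    · change (0 : ℂ).re • p.1 - (0 : ℂ).im • p.2 = 0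
      simp
    · change (0 : ℂ).re • p.2 + (0 : ℂ).im • p.1 = 0
      simp

/-- The inclusion `V → V_ℂ`. -/
def ofReal [Zero V] (v : V) : Complexified V := (v, 0)

end Complexified

end

/-!
The orbit map of `m` pulls `Ω` back to a closed 2-form on `G`. Since `α_g ∘ α(·, m)` is the
orbit map precomposed with left translation by `g`, the invariance of `Ω` makes this form left
invariant: on the left invariant fields of `ξ` and `η` it has the constant value `ω_m(ξ, η)`, so
Cartan's formula for its exterior derivative reduces to the cocycle identity.

The chain rule and the symmetry of second derivatives in a locally convex space come from the mean
value theorem: by Hahn-Banach, a difference quotient lies in every closed convex set that contains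
the derivatives along the segment.

In the Kähler case, `h_m` is the pullback of `H_m` along the complex linear extension of
`ξ ↦ X_ξ(m)`.
-/

section DirectionalDerivatives

variable {𝕜 : Type*} [NontriviallyNormedField 𝕜]
  {E : Type*} [AddCommGroup E] [Module 𝕜 E]
  {E' : Type*} [AddCommGroup E'] [Module 𝕜 E']
  {F : Type*} [AddCommGroup F] [Module 𝕜 F] [TopologicalSpace F]
  {F' : Type*} [AddCommGroup F'] [Module 𝕜 F'] [TopologicalSpace F']
  {f g : E → F} {x v : E} {w w' : F}

theorem HasDirDeriv.unique [T2Space F] (h : HasDirDeriv 𝕜 f x v w) (h' : HasDirDeriv 𝕜 f x v w') :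
    w = w' :=
  tendsto_nhds_unique h h'

theorem hasDirDeriv_dirDeriv (h : ∃ w, HasDirDeriv 𝕜 f x v w) :
    HasDirDeriv 𝕜 f x v (dirDeriv 𝕜 f x v) := by
  rw [dirDeriv, dif_pos h]
  exact h.choose_spec

theorem HasDirDeriv.dirDeriv_eq [T2Space F] (h : HasDirDeriv 𝕜 f x v w) : dirDeriv 𝕜 f x v = w :=
  (hasDirDeriv_dirDeriv ⟨w, h⟩).unique h

theorem HasDirDeriv.congr_of_eventuallyEq (h : HasDirDeriv 𝕜 f x v w)
    (hfg : ∀ᶠ t : 𝕜 in 𝓝[≠] 0, f (x + t • v) = g (x + t • v)) (hx : f x = g x) :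
    HasDirDeriv 𝕜 g x v w :=
  Tendsto.congr' (hfg.mono fun t ht => by rw [ht, hx]) h

theorem HasDirDeriv.comp_line (h : HasDirDeriv 𝕜 f x v w) {c : E' → E} {x' v' : E'}
    (hc : ∀ t : 𝕜, c (x' + t • v') = x + t • v) : HasDirDeriv 𝕜 (fun y => f (c y)) x' v' w := by
  have hx : c x' = x := by simpa using hc 0
  exact Tendsto.congr (fun t => by simp only [hc, hx]) h

theorem hasDirDeriv_const (c : F) (x v : E) : HasDirDeriv 𝕜 (fun _ : E => c) x v 0 :=
  Tendsto.congr (fun t => by simp) tendsto_const_nhds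

theorem hasDirDeriv_of_isLinearMap (hf : IsLinearMap 𝕜 f) (x v : E) :
    HasDirDeriv 𝕜 f x v (f v) := by
  refine Tendsto.congr' ?_ tendsto_const_nhds
  filter_upwards [self_mem_nhdsWithin] with t ht
  rw [hf.map_add, hf.map_smul, add_sub_cancel_left, inv_smul_smul₀ ht]

theorem HasDirDeriv.prodMk {f' : E → F'} {w' : F'} (h : HasDirDeriv 𝕜 f x v w)
    (h' : HasDirDeriv 𝕜 f' x v w') : HasDirDeriv 𝕜 (fun y => (f y, f' y)) x v (w, w') :=
  Tendsto.prodMk_nhds h h'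

theorem HasDirDeriv.sub [IsTopologicalAddGroup F] (hf : HasDirDeriv 𝕜 f x v w)
    (hg : HasDirDeriv 𝕜 g x v w') : HasDirDeriv 𝕜 (fun y => f y - g y) x v (w - w') :=
  Tendsto.congr (fun t => by module) (Tendsto.sub hf hg)

theorem HasDirDeriv.const_smul [ContinuousConstSMul 𝕜 F] (h : HasDirDeriv 𝕜 f x v w) (c : 𝕜) :
    HasDirDeriv 𝕜 (fun y => c • f y) x v (c • w) :=
  Tendsto.congr (fun t => by module) (Tendsto.const_smul h c)

theorem HasDirDeriv.smul_dir [ContinuousConstSMul 𝕜 F] (h : HasDirDeriv 𝕜 f x v w) (c : 𝕜) :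
    HasDirDeriv 𝕜 f x (c • v) (c • w) := by
  rcases eq_or_ne c 0 with rfl | hc
  · exact Tendsto.congr (fun t => by simp) tendsto_const_nhds
  have hmul : Tendsto (fun t : 𝕜 => t * c) (𝓝[≠] 0) (𝓝[≠] 0) := by
    refine tendsto_nhdsWithin_iff.2 ⟨?_, ?_⟩
    · exact (Continuous.tendsto' (by fun_prop) 0 0 (zero_mul c)).mono_left nhdsWithin_le_nhds
    · filter_upwards [self_mem_nhdsWithin] with t ht using mul_ne_zero ht hc
  refine Tendsto.congr (fun t => ?_) (Tendsto.const_smul (h.comp hmul) c)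
  rw [Function.comp_apply, smul_smul, smul_smul, mul_inv_rev, mul_inv_cancel_left₀ hc]

theorem tendsto_add_smul_nhds [TopologicalSpace E] [ContinuousAdd E] [ContinuousSMul 𝕜 E]
    (x v : E) : Tendsto (fun t : 𝕜 => x + t • v) (𝓝[≠] 0) (𝓝 x) :=
  (Continuous.tendsto' (by fun_prop) 0 x (by simp)).mono_left nhdsWithin_le_nhds

theorem dirDeriv_comp_const_add (f : E → F) (A : E' →ₗ[𝕜] E) (c : E) (x v : E') :
    dirDeriv 𝕜 (fun y => f (c + A y)) x v = dirDeriv 𝕜 f (c + A x) (A v) := by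
  classical
  have h : HasDirDeriv 𝕜 (fun y => f (c + A y)) x v = HasDirDeriv 𝕜 f (c + A x) (A v) := by
    funext w
    simp only [HasDirDeriv, map_add, map_smul, add_assoc]
  exact congrArg (fun P : F → Prop => if h : ∃ w, P w then h.choose else 0) h

theorem iterDirDeriv_comp_const_add (f : E → F) (A : E' →ₗ[𝕜] E) (c : E) (k : ℕ) (x : E')
    (v : Fin k → E') : iterDirDeriv 𝕜 (fun y => f (c + A y)) k x v =
      iterDirDeriv 𝕜 f k (c + A x) (A ∘ v) := by
  induction k generalizing x with
  | zero => rfl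
  | succ k ih =>
    simp only [iterDirDeriv, ih]
    exact dirDeriv_comp_const_add (fun z => iterDirDeriv 𝕜 f k z (A ∘ Fin.init v)) A c x _

theorem MBSmoothOn.comp_const_add [TopologicalSpace E] [TopologicalSpace E'] [ContinuousAdd E]
    {U : Set E} (hf : MBSmoothOn 𝕜 f U) (A : E' →L[𝕜] E) (c : E) :
    MBSmoothOn 𝕜 (fun y => f (c + A y)) ((fun y => c + A y) ⁻¹' U) := by
  have hiter := iterDirDeriv_comp_const_add f (A : E' →ₗ[𝕜] E) c
  simp only [ContinuousLinearMap.coe_coe] at hiter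
  refine fun k => ⟨fun x hx v => ?_, ?_⟩
  · obtain ⟨w, hw⟩ := (hf k).1 _ hx (A ∘ v)
    refine ⟨w, ?_⟩
    simp only [hiter]
    exact hw.comp_line fun t => by simp [add_assoc]
  · simp only [hiter]
    exact (hf k).2.comp (f := fun p : E' × (Fin k → E') => (c + A p.1, A ∘ p.2))
      (by fun_prop) fun p hp => ⟨hp.1, mem_univ _⟩

end DirectionalDerivatives

section MeanValue

variable {E : Type*} [AddCommGroup E] [Module ℝ E]

theorem eventually_forall_segment [TopologicalSpace E] [ContinuousAdd E] [ContinuousSMul ℝ E]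
    {ι : Type*} {l : Filter ι} {x v : E} {y u : ι → E} {t : ι → ℝ} {P : ι × E × E → Prop}
    (hP : ∀ᶠ p in l ×ˢ 𝓝 (x, v), P p) (hy : Tendsto y l (𝓝 x)) (hu : Tendsto u l (𝓝 v))
    (ht : Tendsto t l (𝓝 0)) :
    ∀ᶠ i in l, ∀ c ∈ Icc (0 : ℝ) 1, P (i, y i + c • t i • u i, u i) := by
  have hbase (c : ℝ) :
      Tendsto (fun q : ι × ℝ => y q.1 + q.2 • t q.1 • u q.1) (l ×ˢ 𝓝 c) (𝓝 x) := by
    have htu : Tendsto (fun q : ι × ℝ => t q.1 • u q.1) (l ×ˢ 𝓝 c) (𝓝 0) := by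
      simpa only [zero_smul, Function.comp_def] using (ht.smul hu).comp tendsto_fst
    simpa only [smul_zero, add_zero, Function.comp_def] using
      (hy.comp tendsto_fst).add (tendsto_snd.smul htu)
  have hsegment : ∀ c ∈ Icc (0 : ℝ) 1,
      {q : ι × ℝ | P (q.1, y q.1 + q.2 • t q.1 • u q.1, u q.1)} ∈ l ×ˢ 𝓝 c := fun c _ =>
    (tendsto_fst.prodMk ((hbase c).prodMk_nhds (hu.comp tendsto_fst))).eventually hP
  exact eventually_prod_principal_iff.1 <|
    prod_mono_right _ principal_le_nhdsSet (isCompact_Icc.mem_prod_nhdsSet_of_forall hsegment)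

variable {F : Type*} [AddCommGroup F] [Module ℝ F] [TopologicalSpace F]

theorem HasDirDeriv.hasDerivAt_comp {f : E → F} {x v : E} {w : F} {s : ℝ}
    (h : HasDirDeriv ℝ f (x + s • v) v w) (l : F →L[ℝ] ℝ) :
    HasDerivAt (fun r : ℝ => l (f (x + r • v))) (l w) s := by
  rw [hasDerivAt_iff_tendsto_slope_zero]
  refine Tendsto.congr (fun t => ?_) ((l.continuous.tendsto w).comp h)
  simp only [Function.comp_apply, map_smul, map_sub, add_smul, add_assoc]

variable [IsTopologicalAddGroup F] [ContinuousSMul ℝ F] [LocallyConvexSpace ℝ F]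

theorem sub_mem_of_hasDirDeriv {f : E → F} {x v : E} {C : Set F} (hC : Convex ℝ C)
    (hC' : IsClosed C)
    (h : ∀ c ∈ Icc (0 : ℝ) 1, ∃ w ∈ C, HasDirDeriv ℝ f (x + c • v) v w) :
    f (x + v) - f x ∈ C := by
  by_contra hfC
  obtain ⟨l, u, hlu, hul⟩ := geometric_hahn_banach_point_closed hC hC' hfC
  choose! w hwC hw using h
  have hderiv : ∀ c ∈ Icc (0 : ℝ) 1, HasDerivAt (fun r : ℝ => l (f (x + r • v))) (l (w c)) c :=
    fun c hc => (hw c hc).hasDerivAt_comp l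
  obtain ⟨c, hc, hslope⟩ := exists_hasDerivAt_eq_slope (fun r : ℝ => l (f (x + r • v)))
    (fun c => l (w c)) zero_lt_one (fun c hc => (hderiv c hc).continuousAt.continuousWithinAt)
    (fun c hc => hderiv c (Ioo_subset_Icc_self hc))
  have hlw : l (w c) = l (f (x + v) - f x) := by simpa using hslope
  exact lt_asymm (hlw ▸ hul _ (hwC c (Ioo_subset_Icc_self hc))) hlu

theorem exists_isClosed_convex_nhds_subset {y : F} {V : Set F} (hV : V ∈ 𝓝 y) :
    ∃ C ∈ 𝓝 y, IsClosed C ∧ Convex ℝ C ∧ C ⊆ V := by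
  obtain ⟨N, ⟨hN, hNclosed⟩, hNV⟩ := (closed_nhds_basis y).mem_iff.1 hV
  obtain ⟨C, ⟨hC, hCconvex⟩, hCN⟩ := (LocallyConvexSpace.convex_basis (𝕜 := ℝ) y).mem_iff.1 hN
  exact ⟨closure C, mem_of_superset hC subset_closure, isClosed_closure, hCconvex.closure,
    (closure_minimal hCN hNclosed).trans hNV⟩

variable [TopologicalSpace E] [ContinuousAdd E] [ContinuousSMul ℝ E]
  {ι : Type*} {l : Filter ι} {x v : E} {y u : ι → E} {t : ι → ℝ}

theorem tendsto_differenceQuotient {g : ι → E → F} {g' : ι → E × E → F} {w : F}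
    (hg : ∀ᶠ p : ι × E × E in l ×ˢ 𝓝 (x, v), HasDirDeriv ℝ (g p.1) p.2.1 p.2.2 (g' p.1 p.2))
    (hg' : Tendsto (fun p : ι × E × E => g' p.1 p.2) (l ×ˢ 𝓝 (x, v)) (𝓝 w))
    (hy : Tendsto y l (𝓝 x)) (hu : Tendsto u l (𝓝 v)) (ht : Tendsto t l (𝓝[≠] 0)) :
    Tendsto (fun i => (t i)⁻¹ • (g i (y i + t i • u i) - g i (y i))) l (𝓝 w) := by
  refine tendsto_def.2 fun V hV => ?_
  obtain ⟨C, hC, hCclosed, hCconvex, hCV⟩ := exists_isClosed_convex_nhds_subset hV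
  filter_upwards [eventually_forall_segment (hg.and (hg'.eventually_mem hC)) hy hu
    (ht.mono_right nhdsWithin_le_nhds), ht.eventually self_mem_nhdsWithin] with i hi hti
  suffices (t i)⁻¹ • (g i (y i + t i • u i) - g i (y i)) ∈ C from hCV this
  rw [smul_sub]
  refine sub_mem_of_hasDirDeriv (f := fun z => (t i)⁻¹ • g i z) hCconvex hCclosed fun c hc =>
    ⟨_, (hi c hc).2, ?_⟩
  simpa only [inv_smul_smul₀ hti] using ((hi c hc).1.smul_dir (t i)).const_smul (t i)⁻¹

end MeanValue

section ContinuouslyDifferentiable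

variable {E : Type*} [AddCommGroup E] [Module ℝ E] [TopologicalSpace E]
  {F : Type*} [AddCommGroup F] [Module ℝ F] [TopologicalSpace F]
  {F' : Type*} [AddCommGroup F'] [Module ℝ F'] [TopologicalSpace F']

/-- Maps that are continuously differentiable on `U` in the sense of Michal--Bastiani: the
directional derivatives exist and depend jointly continuously on the point and the direction. -/
structure MBC1On (f : E → F) (U : Set E) : Prop where
  continuousOn : ContinuousOn f U
  hasDirDeriv : ∀ x ∈ U, ∀ v, HasDirDeriv ℝ f x v (dirDeriv ℝ f x v)
  continuousOn_dirDeriv : ContinuousOn (fun p : E × E => dirDeriv ℝ f p.1 p.2) (U ×ˢ univ)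

/-- Maps that are twice continuously differentiable on `U`; the first derivative is regarded as a
map on `U × E`. -/
structure MBC2On (f : E → F) (U : Set E) : Prop extends MBC1On f U where
  mbC1On_dirDeriv : MBC1On (fun p : E × E => dirDeriv ℝ f p.1 p.2) (U ×ˢ univ)

variable {f : E → F} {U : Set E} {x v : E}

theorem mbC1On_of_hasDirDeriv [T2Space F] {f' : E → E → F} (hf : ContinuousOn f U)
    (hf' : ∀ x ∈ U, ∀ v, HasDirDeriv ℝ f x v (f' x v))
    (hf'_cont : ContinuousOn (fun p : E × E => f' p.1 p.2) (U ×ˢ univ)) : MBC1On f U where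
  continuousOn := hf
  hasDirDeriv x hx v := hasDirDeriv_dirDeriv ⟨_, hf' x hx v⟩
  continuousOn_dirDeriv := hf'_cont.congr fun p hp => (hf' p.1 hp.1 p.2).dirDeriv_eq

theorem MBC1On.dirDeriv_smul [T2Space F] [ContinuousConstSMul ℝ F] (hf : MBC1On f U) (hx : x ∈ U)
    (c : ℝ) (v : E) : dirDeriv ℝ f x (c • v) = c • dirDeriv ℝ f x v :=
  ((hf.hasDirDeriv x hx v).smul_dir c).dirDeriv_eq

theorem MBC1On.prodMk {f' : E → F'} [T2Space F] [T2Space F'] (hf : MBC1On f U)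
    (hf' : MBC1On f' U) : MBC1On (fun x => (f x, f' x)) U :=
  mbC1On_of_hasDirDeriv (hf.continuousOn.prodMk hf'.continuousOn)
    (fun x hx v => (hf.hasDirDeriv x hx v).prodMk (hf'.hasDirDeriv x hx v))
    (hf.continuousOn_dirDeriv.prodMk hf'.continuousOn_dirDeriv)

theorem mbC1On_clm [T2Space F] (A : E →L[ℝ] F) (U : Set E) : MBC1On A U :=
  mbC1On_of_hasDirDeriv A.continuous.continuousOn
    (fun x _ v => hasDirDeriv_of_isLinearMap A.toLinearMap.isLinear x v)
    (A.continuous.comp continuous_snd).continuousOn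

theorem MBSmoothOn.mbC1On (hf : MBSmoothOn ℝ f U) : MBC1On f U where
  continuousOn := (hf 0).2.comp (f := fun x => (x, Fin.elim0)) (by fun_prop)
    fun x hx => ⟨hx, mem_univ _⟩
  hasDirDeriv x hx v := hasDirDeriv_dirDeriv ((hf 0).1 x hx fun _ => v)
  continuousOn_dirDeriv := (hf 1).2.comp (f := fun p : E × E => (p.1, fun _ => p.2)) (by fun_prop)
    fun p hp => ⟨hp.1, mem_univ _⟩

theorem MBSmoothOn.hasDirDeriv_dirDeriv (hf : MBSmoothOn ℝ f U) (hx : x ∈ U) (u v : E) :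
    HasDirDeriv ℝ (fun y => dirDeriv ℝ f y u) x v
      (dirDeriv ℝ (fun y => dirDeriv ℝ f y u) x v) :=
  _root_.hasDirDeriv_dirDeriv ((hf 1).1 x hx ![u, v])

theorem MBSmoothOn.continuousOn_dirDeriv_dirDeriv (hf : MBSmoothOn ℝ f U) :
    ContinuousOn (fun p : E × E × E => dirDeriv ℝ (fun y => dirDeriv ℝ f y p.2.1) p.1 p.2.2)
      (U ×ˢ univ) :=
  (hf 2).2.comp (f := fun p : E × E × E => (p.1, ![p.2.1, p.2.2])) (by fun_prop)
    fun _ hp => ⟨hp.1, mem_univ _⟩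

theorem MBC2On.hasDirDeriv_dirDeriv (hf : MBC2On f U) (hx : x ∈ U) (u v : E) :
    HasDirDeriv ℝ (fun y => dirDeriv ℝ f y u) x v
      (dirDeriv ℝ (fun y => dirDeriv ℝ f y u) x v) :=
  _root_.hasDirDeriv_dirDeriv ⟨_, (hf.mbC1On_dirDeriv.hasDirDeriv (x, u) ⟨hx, mem_univ u⟩
    (v, 0)).comp_line (c := fun y => (y, u)) fun t => by simp⟩

section LocallyConvex

variable [IsTopologicalAddGroup F] [ContinuousSMul ℝ F] [LocallyConvexSpace ℝ F]
  [ContinuousAdd E] [ContinuousSMul ℝ E]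

theorem MBC1On.tendsto_differenceQuotient (hf : MBC1On f U) (hU : IsOpen U) (hx : x ∈ U)
    {ι : Type*} {l : Filter ι} {y u : ι → E} {t : ι → ℝ} (hy : Tendsto y l (𝓝 x))
    (hu : Tendsto u l (𝓝 v)) (ht : Tendsto t l (𝓝[≠] 0)) :
    Tendsto (fun i => (t i)⁻¹ • (f (y i + t i • u i) - f (y i))) l (𝓝 (dirDeriv ℝ f x v)) := by
  have hUx : U ×ˢ univ ∈ 𝓝 (x, v) := (hU.prod isOpen_univ).mem_nhds ⟨hx, mem_univ v⟩
  refine _root_.tendsto_differenceQuotient (g := fun _ => f)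
    (g' := fun _ p => dirDeriv ℝ f p.1 p.2) ?_ ?_ hy hu ht
  · filter_upwards [tendsto_snd.eventually_mem hUx] with p hp
    exact hf.hasDirDeriv p.2.1 hp.1 p.2.2
  · exact (hf.continuousOn_dirDeriv.continuousAt hUx).tendsto.comp tendsto_snd

theorem MBC1On.hasDirDeriv_comp (hf : MBC1On f U) (hU : IsOpen U) {E' : Type*} [AddCommGroup E']
    [Module ℝ E'] {c : E' → E} {x' v' : E'} (hx : c x' ∈ U) (hc : HasDirDeriv ℝ c x' v' v) :
    HasDirDeriv ℝ (fun y => f (c y)) x' v' (dirDeriv ℝ f (c x') v) := by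
  refine Tendsto.congr' ?_
    (hf.tendsto_differenceQuotient hU hx tendsto_const_nhds hc tendsto_id)
  filter_upwards [self_mem_nhdsWithin] with t ht
  rw [id, smul_inv_smul₀ ht, add_sub_cancel]

theorem MBC1On.comp [T2Space F] {E' : Type*} [AddCommGroup E'] [Module ℝ E'] [TopologicalSpace E']
    {c : E' → E} {V : Set E'} (hf : MBC1On f U) (hU : IsOpen U) (hc : MBC1On c V)
    (hcV : MapsTo c V U) : MBC1On (fun y => f (c y)) V :=
  mbC1On_of_hasDirDeriv (hf.continuousOn.comp hc.continuousOn hcV)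
    (fun y hy v => hf.hasDirDeriv_comp hU (hcV hy) (hc.hasDirDeriv y hy v))
    (hf.continuousOn_dirDeriv.comp (f := fun p : E' × E' => (c p.1, dirDeriv ℝ c p.1 p.2))
      ((hc.continuousOn.comp continuousOn_fst fun _ hp => hp.1).prodMk hc.continuousOn_dirDeriv)
      fun _ hp => ⟨hcV hp.1, mem_univ _⟩)

variable [T2Space F]

theorem MBC1On.dirDeriv_add (hf : MBC1On f U) (hU : IsOpen U) (hx : x ∈ U) (u v : E) :
    dirDeriv ℝ f x (u + v) = dirDeriv ℝ f x u + dirDeriv ℝ f x v := by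
  have hv := hf.tendsto_differenceQuotient hU hx (tendsto_add_smul_nhds x u)
    (tendsto_const_nhds (x := v)) tendsto_id
  refine HasDirDeriv.dirDeriv_eq <|
    Tendsto.congr (fun t => ?_) (Tendsto.add (hf.hasDirDeriv x hx u) hv)
  rw [id, ← smul_add, sub_add_sub_cancel', smul_add, ← add_assoc]

/-- The derivative at a point of a continuously differentiable map, as a continuous linear map. -/
noncomputable def MBC1On.dirDerivCLM (hf : MBC1On f U) (hU : IsOpen U) (hx : x ∈ U) :
    E →L[ℝ] F where
  toFun := dirDeriv ℝ f x
  map_add' := hf.dirDeriv_add hU hx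
  map_smul' := hf.dirDeriv_smul hx
  cont := hf.continuousOn_dirDeriv.comp_continuous (Continuous.prodMk_right x)
    fun v => ⟨hx, mem_univ v⟩

theorem MBSmoothOn.hasDirDeriv_dirDeriv_prod (hf : MBSmoothOn ℝ f U) (hU : IsOpen U) (hx : x ∈ U)
    (u a b : E) :
    HasDirDeriv ℝ (fun p : E × E => dirDeriv ℝ f p.1 p.2) (x, u) (a, b)
      (dirDeriv ℝ (fun y => dirDeriv ℝ f y u) x a + dirDeriv ℝ f x b) := by
  have hf₁ := hf.mbC1On
  have hcont : ContinuousAt (fun p : E × E => dirDeriv ℝ f p.1 p.2) (x, b) :=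
    hf₁.continuousOn_dirDeriv.continuousAt ((hU.prod isOpen_univ).mem_nhds ⟨hx, mem_univ b⟩)
  have hmove : Tendsto (fun t : ℝ => dirDeriv ℝ f (x + t • a) b) (𝓝[≠] 0)
      (𝓝 (dirDeriv ℝ f x b)) :=
    hcont.tendsto.comp (f := fun t : ℝ => (x + t • a, b))
      ((tendsto_add_smul_nhds x a).prodMk_nhds tendsto_const_nhds)
  refine Tendsto.congr' ?_ (Tendsto.add (hf.hasDirDeriv_dirDeriv hx u a) hmove)
  filter_upwards [self_mem_nhdsWithin,
    (tendsto_add_smul_nhds x a).eventually_mem (hU.mem_nhds hx)] with t ht htU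
  simp only [Prod.mk_add_mk, Prod.smul_mk]
  rw [hf₁.dirDeriv_add hU htU, hf₁.dirDeriv_smul htU, add_sub_right_comm, smul_add,
    inv_smul_smul₀ ht]

theorem MBSmoothOn.mbC2On (hf : MBSmoothOn ℝ f U) (hU : IsOpen U) : MBC2On f U where
  toMBC1On := hf.mbC1On
  mbC1On_dirDeriv := by
    refine mbC1On_of_hasDirDeriv
      (f' := fun p q => dirDeriv ℝ (fun y => dirDeriv ℝ f y p.2) p.1 q.1 + dirDeriv ℝ f p.1 q.2)
      hf.mbC1On.continuousOn_dirDeriv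
      (fun p hp q => hf.hasDirDeriv_dirDeriv_prod hU hp.1 p.2 q.1 q.2) ?_
    exact (hf.continuousOn_dirDeriv_dirDeriv.comp
      (f := fun q : (E × E) × E × E => (q.1.1, q.1.2, q.2.1)) (by fun_prop)
      fun q hq => ⟨hq.1.1, mem_univ _⟩).add
      (hf.mbC1On.continuousOn_dirDeriv.comp (f := fun q : (E × E) × E × E => (q.1.1, q.2.2))
      (by fun_prop) fun q hq => ⟨hq.1.1, mem_univ _⟩)

theorem MBC2On.tendsto_secondDifference (hf : MBC2On f U) (hU : IsOpen U) (hx : x ∈ U) (u v : E) :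
    Tendsto (fun t : ℝ => t⁻¹ • (t⁻¹ • (f (x + t • u + t • v) - f (x + t • u)) -
      t⁻¹ • (f (x + t • v) - f x))) (𝓝[≠] 0) (𝓝 (dirDeriv ℝ (fun y => dirDeriv ℝ f y u) x v)) := by
  have hvalue : dirDeriv ℝ (fun p : E × E => dirDeriv ℝ f p.1 p.2) (x, u) (v, 0) =
      dirDeriv ℝ (fun y => dirDeriv ℝ f y u) x v :=
    ((hf.mbC1On_dirDeriv.hasDirDeriv (x, u) ⟨hx, mem_univ u⟩ (v, 0)).comp_line
      (c := fun y => (y, u)) fun t => by simp).dirDeriv_eq.symm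
  have hshift : Tendsto (fun p : ℝ × E × E => p.2.1 + p.1 • v) (𝓝[≠] 0 ×ˢ 𝓝 (x, u)) (𝓝 x) :=
    (Continuous.tendsto' (by fun_prop) (0, x, u) x (by simp)).mono_left
      (nhds_prod_eq (x := (0 : ℝ)) (y := (x, u)) ▸ prod_mono_left _ nhdsWithin_le_nhds)
  refine tendsto_differenceQuotient (g := fun t y => t⁻¹ • (f (y + t • v) - f y))
    (g' := fun t p => t⁻¹ • (dirDeriv ℝ f (p.1 + t • v) p.2 - dirDeriv ℝ f p.1 p.2))
    ?_ ?_ tendsto_const_nhds tendsto_const_nhds tendsto_id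
  · filter_upwards [hshift.eventually_mem (hU.mem_nhds hx),
      (continuous_fst.tendsto' (x, u) x rfl |>.comp tendsto_snd).eventually_mem
        (hU.mem_nhds hx)] with p hpv hp
    exact (((hf.hasDirDeriv _ hpv p.2.2).comp_line (c := fun y => y + p.1 • v)
      fun t => add_right_comm _ _ _).sub (hf.hasDirDeriv _ hp p.2.2)).const_smul p.1⁻¹
  · rw [← hvalue]
    simpa using hf.mbC1On_dirDeriv.tendsto_differenceQuotient (hU.prod isOpen_univ)
      (x := (x, u)) (v := (v, 0)) ⟨hx, mem_univ u⟩
      (tendsto_snd (f := 𝓝[≠] (0 : ℝ)) (g := 𝓝 (x, u))) tendsto_const_nhds tendsto_fst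

theorem MBC2On.dirDeriv_comm (hf : MBC2On f U) (hU : IsOpen U) (hx : x ∈ U) (u v : E) :
    dirDeriv ℝ (fun y => dirDeriv ℝ f y u) x v = dirDeriv ℝ (fun y => dirDeriv ℝ f y v) x u := by
  refine tendsto_nhds_unique (hf.tendsto_secondDifference hU hx u v)
    (Tendsto.congr (fun t => ?_) (hf.tendsto_secondDifference hU hx v u))
  rw [add_right_comm x (t • v) (t • u)]
  module

end LocallyConvex

end ContinuouslyDifferentiable

section TwoForms

variable {E : Type*} [AddCommGroup E] [Module ℝ E] [TopologicalSpace E]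
  {F : Type*} [AddCommGroup F] [Module ℝ F] [TopologicalSpace F]

theorem hasDirDeriv_bilinear_apply [ContinuousAdd E] [ContinuousSMul ℝ E]
    [ContinuousAdd F] [ContinuousSMul ℝ F]
    {F' : Type*} [AddCommGroup F'] [Module ℝ F'] [TopologicalSpace F'] [ContinuousAdd F']
    [ContinuousSMul ℝ F'] {R : Type*} [AddCommGroup R] [Module ℝ R] [TopologicalSpace R]
    [IsTopologicalAddGroup R] [ContinuousSMul ℝ R] [LocallyConvexSpace ℝ R] [T2Space R]
    {B : E → F → F' → R} {V : Set E}
    (hB : MBC1On (fun p : E × F × F' => B p.1 p.2.1 p.2.2) (V ×ˢ univ)) (hV : IsOpen V)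
    {E' : Type*} [AddCommGroup E'] [Module ℝ E'] {c : E' → E} {X : E' → F} {Y : E' → F'}
    {x v : E'} {c' : E} {X' : F} {Y' : F'} (hx : c x ∈ V)
    (hleft : IsLinearMap ℝ fun a => B (c x) a (Y x))
    (hright : IsLinearMap ℝ fun b => B (c x) (X x) b)
    (hc : HasDirDeriv ℝ c x v c') (hX : HasDirDeriv ℝ X x v X') (hY : HasDirDeriv ℝ Y x v Y') :
    HasDirDeriv ℝ (fun y => B (c y) (X y) (Y y)) x v
      (dirDeriv ℝ (fun y => B y (X x) (Y x)) (c x) c' + B (c x) X' (Y x) + B (c x) (X x) Y') := by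
  set b : E × F × F' → R := fun p => B p.1 p.2.1 p.2.2
  set p : E × F × F' := (c x, X x, Y x)
  have hVU : IsOpen (V ×ˢ (univ : Set (F × F'))) := hV.prod isOpen_univ
  have hp : p ∈ V ×ˢ (univ : Set (F × F')) := ⟨hx, mem_univ _⟩
  have hbase : dirDeriv ℝ (fun y => B y (X x) (Y x)) (c x) c' = dirDeriv ℝ b p (c', 0, 0) :=
    ((hB.hasDirDeriv p hp _).comp_line (c := fun y => (y, X x, Y x))
      fun t => by simp [p]).dirDeriv_eq
  have hfst : B (c x) X' (Y x) = dirDeriv ℝ b p (0, X', 0) :=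
    (hasDirDeriv_of_isLinearMap hleft (X x) X').unique
      ((hB.hasDirDeriv p hp _).comp_line (c := fun a => (c x, a, Y x)) fun t => by simp [p])
  have hsnd : B (c x) (X x) Y' = dirDeriv ℝ b p (0, 0, Y') :=
    (hasDirDeriv_of_isLinearMap hright (Y x) Y').unique
      ((hB.hasDirDeriv p hp _).comp_line (c := fun a => (c x, X x, a)) fun t => by simp [p])
  rw [hbase, hfst, hsnd, ← hB.dirDeriv_add hVU hp, ← hB.dirDeriv_add hVU hp]
  simpa [b] using hB.hasDirDeriv_comp hVU (c := fun y => (c y, X y, Y y)) hp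
    (hc.prodMk (hX.prodMk hY))

/-- Continuously differentiable closed 2-forms on a subset `V` of `E`, given by their values
`B x u v` on vectors `u`, `v` at the point `x`. -/
structure IsClosedTwoFormOn (B : E → E → E → ℝ) (V : Set E) : Prop where
  mbC1On : MBC1On (fun p : E × E × E => B p.1 p.2.1 p.2.2) (V ×ˢ univ)
  linear_left : ∀ x ∈ V, ∀ v, IsLinearMap ℝ fun u => B x u v
  linear_right : ∀ x ∈ V, ∀ u, IsLinearMap ℝ fun v => B x u v
  alternating : ∀ x ∈ V, ∀ v, B x v v = 0
  closed : ∀ x ∈ V, ∀ u v w, dirDeriv ℝ (fun y => B y v w) x u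
    + dirDeriv ℝ (fun y => B y w u) x v + dirDeriv ℝ (fun y => B y u v) x w = 0

/-- The pullback `f^*B` of a 2-form `B` under a map `f`. -/
noncomputable def pullbackForm (f : E → F) (B : F → F → F → ℝ) (x u v : E) : ℝ :=
  B (f x) (dirDeriv ℝ f x u) (dirDeriv ℝ f x v)

/-- The Lie bracket `[X, Y] = DY(X) - DX(Y)` of vector fields on a vector space. -/
noncomputable def localBracket (X Y : E → E) (x : E) : E :=
  dirDeriv ℝ Y x (X x) - dirDeriv ℝ X x (Y x)

namespace IsClosedTwoFormOn

theorem swap {B : E → E → E → ℝ} {V : Set E} (hB : IsClosedTwoFormOn B V) {x : E} (hx : x ∈ V)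
    (u v : E) : B x u v = -B x v u := by
  have h := hB.alternating x hx (u + v)
  rw [(hB.linear_left x hx _).map_add, (hB.linear_right x hx u).map_add,
    (hB.linear_right x hx v).map_add, hB.alternating x hx, hB.alternating x hx] at h
  linarith

section Pullback

variable [ContinuousSMul ℝ F]
  {B : F → F → F → ℝ} {V : Set F} {f : E → F} {U : Set E}

theorem dirDeriv_pullbackForm [ContinuousAdd F] (hB : IsClosedTwoFormOn B V) (hV : IsOpen V)
    (hf : MBC2On f U) (hUV : MapsTo f U V) {x : E} (hx : x ∈ U) (u v w : E) :
    dirDeriv ℝ (fun y => pullbackForm f B y v w) x u =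
      dirDeriv ℝ (fun z => B z (dirDeriv ℝ f x v) (dirDeriv ℝ f x w)) (f x) (dirDeriv ℝ f x u)
      + B (f x) (dirDeriv ℝ (fun y => dirDeriv ℝ f y v) x u) (dirDeriv ℝ f x w)
      + B (f x) (dirDeriv ℝ f x v) (dirDeriv ℝ (fun y => dirDeriv ℝ f y w) x u) :=
  (hasDirDeriv_bilinear_apply hB.mbC1On hV (hUV hx) (hB.linear_left _ (hUV hx) _)
    (hB.linear_right _ (hUV hx) _) (hf.hasDirDeriv x hx u) (hf.hasDirDeriv_dirDeriv hx v u)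
    (hf.hasDirDeriv_dirDeriv hx w u)).dirDeriv_eq

variable [IsTopologicalAddGroup F] [LocallyConvexSpace ℝ F] [T2Space F]
  [ContinuousAdd E] [ContinuousSMul ℝ E] [T2Space E]

theorem mbC1On_pullbackForm (hB : IsClosedTwoFormOn B V) (hV : IsOpen V) (hf : MBC2On f U)
    (hU : IsOpen U) (hUV : MapsTo f U V) :
    MBC1On (fun p : E × E × E => pullbackForm f B p.1 p.2.1 p.2.2) (U ×ˢ univ) := by
  have hpoint : MBC1On (fun p : E × E × E => f p.1) (U ×ˢ univ) :=
    hf.toMBC1On.comp hU (mbC1On_clm (.fst ℝ E (E × E)) _) fun p hp => hp.1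
  have hderiv (A : E × E →L[ℝ] E) :
      MBC1On (fun p : E × E × E => dirDeriv ℝ f p.1 (A p.2)) (U ×ˢ univ) :=
    hf.mbC1On_dirDeriv.comp (hU.prod isOpen_univ) (c := fun p : E × E × E => (p.1, A p.2))
      (mbC1On_clm ((ContinuousLinearMap.id ℝ E).prodMap A) _) fun p hp => ⟨hp.1, mem_univ _⟩
  have htriple := hpoint.prodMk ((hderiv (.fst ℝ E E)).prodMk (hderiv (.snd ℝ E E)))
  exact hB.mbC1On.comp (hV.prod isOpen_univ) htriple fun p hp => ⟨hUV hp.1, mem_univ _⟩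

theorem pullback (hB : IsClosedTwoFormOn B V) (hV : IsOpen V) (hf : MBC2On f U) (hU : IsOpen U)
    (hUV : MapsTo f U V) : IsClosedTwoFormOn (pullbackForm f B) U where
  mbC1On := hB.mbC1On_pullbackForm hV hf hU hUV
  linear_left x hx v := ((hB.linear_left (f x) (hUV hx) (dirDeriv ℝ f x v)).mk' _ ∘ₗ
    (hf.toMBC1On.dirDerivCLM hU hx).toLinearMap).isLinear
  linear_right x hx u := ((hB.linear_right (f x) (hUV hx) (dirDeriv ℝ f x u)).mk' _ ∘ₗ
    (hf.toMBC1On.dirDerivCLM hU hx).toLinearMap).isLinear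
  alternating x hx v := hB.alternating (f x) (hUV hx) _
  closed x hx u v w := by
    rw [hB.dirDeriv_pullbackForm hV hf hUV hx, hB.dirDeriv_pullbackForm hV hf hUV hx,
      hB.dirDeriv_pullbackForm hV hf hUV hx, hf.dirDeriv_comm hU hx v u,
      hf.dirDeriv_comm hU hx w u, hf.dirDeriv_comm hU hx w v]
    linarith [hB.closed (f x) (hUV hx) (dirDeriv ℝ f x u) (dirDeriv ℝ f x v) (dirDeriv ℝ f x w),
      hB.swap (hUV hx) (dirDeriv ℝ (fun y => dirDeriv ℝ f y u) x v) (dirDeriv ℝ f x w),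
      hB.swap (hUV hx) (dirDeriv ℝ (fun y => dirDeriv ℝ f y u) x w) (dirDeriv ℝ f x v),
      hB.swap (hUV hx) (dirDeriv ℝ (fun y => dirDeriv ℝ f y v) x w) (dirDeriv ℝ f x u)]

end Pullback

variable [ContinuousAdd E] [ContinuousSMul ℝ E]
  {B : E → E → E → ℝ} {V : Set E} {x : E} {X Y Z : E → E}

theorem dirDeriv_add_add_eq_zero_of_const (hB : IsClosedTwoFormOn B V) (hV : IsOpen V)
    (hx : x ∈ V) {v X' Y' : E} (hX : HasDirDeriv ℝ X x v X') (hY : HasDirDeriv ℝ Y x v Y')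
    (hXY : ∀ y ∈ V, B y (X y) (Y y) = B x (X x) (Y x)) :
    dirDeriv ℝ (fun y => B y (X x) (Y x)) x v + B x X' (Y x) + B x (X x) Y' = 0 := by
  have hid : HasDirDeriv ℝ (fun y : E => y) x v v :=
    hasDirDeriv_of_isLinearMap LinearMap.id.isLinear x v
  have hzero : HasDirDeriv ℝ (fun y => B y (X y) (Y y)) x v 0 := by
    refine (hasDirDeriv_const (B x (X x) (Y x)) x v).congr_of_eventuallyEq ?_ rfl
    filter_upwards [(tendsto_add_smul_nhds x v).eventually_mem (hV.mem_nhds hx)] with t ht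
    exact (hXY _ ht).symm
  exact (hasDirDeriv_bilinear_apply hB.mbC1On hV hx (hB.linear_left x hx _)
    (hB.linear_right x hx _) hid hX hY).unique hzero

theorem cocycle_of_const (hB : IsClosedTwoFormOn B V) (hV : IsOpen V) (hx : x ∈ V)
    (hX : ∀ v, ∃ w, HasDirDeriv ℝ X x v w) (hY : ∀ v, ∃ w, HasDirDeriv ℝ Y x v w)
    (hZ : ∀ v, ∃ w, HasDirDeriv ℝ Z x v w)
    (hXY : ∀ y ∈ V, B y (X y) (Y y) = B x (X x) (Y x))
    (hYZ : ∀ y ∈ V, B y (Y y) (Z y) = B x (Y x) (Z x))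
    (hZX : ∀ y ∈ V, B y (Z y) (X y) = B x (Z x) (X x)) :
    B x (localBracket X Y x) (Z x) + B x (localBracket Y Z x) (X x)
      + B x (localBracket Z X x) (Y x) = 0 := by
  have hYZX := hB.dirDeriv_add_add_eq_zero_of_const hV hx (hasDirDeriv_dirDeriv (hY (X x)))
    (hasDirDeriv_dirDeriv (hZ (X x))) hYZ
  have hZXY := hB.dirDeriv_add_add_eq_zero_of_const hV hx (hasDirDeriv_dirDeriv (hZ (Y x)))
    (hasDirDeriv_dirDeriv (hX (Y x))) hZX
  have hXYZ := hB.dirDeriv_add_add_eq_zero_of_const hV hx (hasDirDeriv_dirDeriv (hX (Z x)))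
    (hasDirDeriv_dirDeriv (hY (Z x))) hXY
  simp only [localBracket, (hB.linear_left x hx _).map_sub]
  linarith [hB.closed x hx (X x) (Y x) (Z x), hB.swap hx (dirDeriv ℝ X x (Y x)) (Z x),
    hB.swap hx (dirDeriv ℝ Y x (Z x)) (X x), hB.swap hx (dirDeriv ℝ Z x (X x)) (Y x)]

end IsClosedTwoFormOn

end TwoForms

section Charts

section Expressions

variable {E F M N : Type*} [TopologicalSpace E] [TopologicalSpace F] [TopologicalSpace M]
  [TopologicalSpace N]

/-- The expression of a map `f : M → N` in the charts `e` of `M` and `e'` of `N`. -/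
def inCharts (e : OpenPartialHomeomorph M E) (e' : OpenPartialHomeomorph N F) (f : M → N) (x : E) :
    F :=
  e' (f (e.symm x))

/-- The set on which the expression of `f` in the charts `e` and `e'` is meaningful. -/
def inChartsDomain (e : OpenPartialHomeomorph M E) (e' : OpenPartialHomeomorph N F) (f : M → N) :
    Set E :=
  e.target ∩ e.symm ⁻¹' (f ⁻¹' e'.source)

variable {e : OpenPartialHomeomorph M E} {e' : OpenPartialHomeomorph N F} {f : M → N} {p : M}

theorem isOpen_inChartsDomain (e : OpenPartialHomeomorph M E) (e' : OpenPartialHomeomorph N F)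
    (hf : Continuous f) : IsOpen (inChartsDomain e e' f) :=
  e.continuousOn_symm.isOpen_inter_preimage e.open_target (e'.open_source.preimage hf)

theorem mem_inChartsDomain (hp : p ∈ e.source) (hfp : f p ∈ e'.source) :
    e p ∈ inChartsDomain e e' f :=
  ⟨e.map_source hp, by simpa only [mem_preimage, e.left_inv hp] using hfp⟩

theorem inCharts_apply (hp : p ∈ e.source) : inCharts e e' f (e p) = e' (f p) := by
  rw [inCharts, e.left_inv hp]

end Expressions

variable {E : Type*} [AddCommGroup E] [Module ℝ E] [TopologicalSpace E]
  {F : Type*} [AddCommGroup F] [Module ℝ F] [TopologicalSpace F]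
  {F' : Type*} [AddCommGroup F'] [Module ℝ F'] [TopologicalSpace F']
  {M : Type*} [TopologicalSpace M] {N : Type*} [TopologicalSpace N]
  {P : Type*} [TopologicalSpace P]

/-- The tangent map of `f` at `p`, with tangent vectors at `p` and `f p` expressed in the charts
`e` and `e'`. -/
noncomputable def chartDeriv (e : OpenPartialHomeomorph M E) (e' : OpenPartialHomeomorph N F)
    (f : M → N) (p : M) (v : E) : F :=
  dirDeriv ℝ (inCharts e e' f) (e p) v

variable {e : OpenPartialHomeomorph M E} {e' : OpenPartialHomeomorph N F}
  {e'' : OpenPartialHomeomorph P F'} {f : M → N} {g : N → P} {p : M}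

theorem chartDeriv_id_self [ContinuousAdd E] [ContinuousSMul ℝ E] [T2Space E]
    (hp : p ∈ e.source) (v : E) : chartDeriv e e id p v = v := by
  have hid : HasDirDeriv ℝ (fun x : E => x) (e p) v v :=
    hasDirDeriv_of_isLinearMap LinearMap.id.isLinear _ v
  refine (hid.congr_of_eventuallyEq ?_ (inCharts_apply (f := id) hp).symm).dirDeriv_eq
  filter_upwards [(tendsto_add_smul_nhds (𝕜 := ℝ) (e p) v).eventually_mem
    (e.open_target.mem_nhds (e.map_source hp))] with t ht
  exact (e.right_inv ht).symm

variable [ChartedSpace E M] [ChartedSpace F N] [ChartedSpace F' P]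

theorem IsLCManifold.lcSmooth_id (hM : IsLCManifold ℝ E M) : LCSmooth ℝ E E (id : M → M) :=
  ⟨continuous_id, hM.smooth_transition⟩

namespace LCSmooth

theorem mbSmoothOn_inCharts (hf : LCSmooth ℝ E F f) (he : e ∈ atlas E M) (he' : e' ∈ atlas F N) :
    MBSmoothOn ℝ (inCharts e e' f) (inChartsDomain e e' f) :=
  hf.2 e he e' he'

variable [ContinuousAdd E] [ContinuousSMul ℝ E]

/-- The tangent map of a smooth map in charts, as a continuous linear map. -/
noncomputable def chartDerivCLM [IsTopologicalAddGroup F] [ContinuousSMul ℝ F]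
    [LocallyConvexSpace ℝ F] [T2Space F] (hf : LCSmooth ℝ E F f) (he : e ∈ atlas E M)
    (he' : e' ∈ atlas F N) (hp : p ∈ e.source) (hfp : f p ∈ e'.source) : E →L[ℝ] F :=
  (hf.mbSmoothOn_inCharts he he').mbC1On.dirDerivCLM (isOpen_inChartsDomain e e' hf.1)
    (mem_inChartsDomain hp hfp)

theorem chartDeriv_comp [ContinuousAdd F] [ContinuousSMul ℝ F] [IsTopologicalAddGroup F']
    [ContinuousSMul ℝ F'] [LocallyConvexSpace ℝ F'] [T2Space F']
    (hg : LCSmooth ℝ F F' g) (hf : LCSmooth ℝ E F f) (he : e ∈ atlas E M) (he' : e' ∈ atlas F N)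
    (he'' : e'' ∈ atlas F' P) {q : N} (hpq : f p = q) (hp : p ∈ e.source) (hq : q ∈ e'.source)
    (hgq : g q ∈ e''.source) (v : E) :
    chartDeriv e e'' (fun x => g (f x)) p v = chartDeriv e' e'' g q (chartDeriv e e' f p v) := by
  subst hpq
  have hep : e p ∈ inChartsDomain e e' f := mem_inChartsDomain hp hq
  have hfp : inCharts e e' f (e p) = e' (f p) := inCharts_apply hp
  have hcomp := (hg.mbSmoothOn_inCharts he' he'').mbC1On.hasDirDeriv_comp
    (isOpen_inChartsDomain e' e'' hg.1) (hfp ▸ mem_inChartsDomain hq hgq)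
    ((hf.mbSmoothOn_inCharts he he').mbC1On.hasDirDeriv (e p) hep v)
  have hchange {x : E} (hx : x ∈ inChartsDomain e e' f) :
      inCharts e' e'' g (inCharts e e' f x) = inCharts e e'' (fun x => g (f x)) x := by
    simp only [inCharts, e'.left_inv hx.2]
  rw [hfp] at hcomp
  refine (hcomp.congr_of_eventuallyEq ?_ (hchange hep)).dirDeriv_eq
  filter_upwards [(tendsto_add_smul_nhds (𝕜 := ℝ) (e p) v).eventually_mem
    ((isOpen_inChartsDomain e e' hf.1).mem_nhds hep)] with t ht using hchange ht

end LCSmooth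

theorem fieldInChart_apply (hp : p ∈ e.source) (X : (m : M) → LCTangent E m) :
    fieldInChart ℝ e X (e p) = chartDeriv (chartAt E p) e id p (X p) := by
  rw [fieldInChart, e.left_inv hp]
  rfl

theorem formInChart_apply {R : Type*} (B : (m : M) → LCTangent E m → LCTangent E m → R)
    (hp : p ∈ e.source) (u v : E) : formInChart B e (e p) u v =
      B p (chartDeriv e (chartAt E p) id p u) (chartDeriv e (chartAt E p) id p v) := by
  rw [formInChart, tangentOfCoord, tangentOfCoord, e.left_inv hp]
  rfl

theorem continuous_of_continuousOn_formInChart [ContinuousAdd E] [ContinuousSMul ℝ E] [T2Space E]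
    {R : Type*} [TopologicalSpace R] {B : (m : M) → LCTangent E m → LCTangent E m → R} (p : M)
    (hB : ContinuousOn (fun q : E × E × E => formInChart B (chartAt E p) q.1 q.2.1 q.2.2)
      ((chartAt E p).target ×ˢ univ)) : Continuous fun q : E × E => B p q.1 q.2 := by
  have hp := mem_chart_source E p
  refine (hB.comp_continuous (Continuous.prodMk_right (chartAt E p p))
    fun q => ⟨(chartAt E p).map_source hp, mem_univ q⟩).congr fun q => ?_
  rw [Function.comp_apply, formInChart_apply B hp, chartDeriv_id_self hp, chartDeriv_id_self hp]

theorem IsLCManifold.isLinearMap_tangentOfCoord [IsTopologicalAddGroup E] [ContinuousSMul ℝ E]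
    [LocallyConvexSpace ℝ E] [T2Space E] (hM : IsLCManifold ℝ E M) (he : e ∈ atlas E M) {x : E}
    (hx : x ∈ e.target) : IsLinearMap ℝ (tangentOfCoord ℝ e x) := by
  have hlinear := (hM.lcSmooth_id.chartDerivCLM he (chart_mem_atlas E (e.symm x))
    (e.map_target hx) (mem_chart_source E (e.symm x))).toLinearMap.isLinear
  have hcoord : tangentOfCoord ℝ e x = chartDeriv e (chartAt E (e.symm x)) id (e.symm x) := by
    funext u
    rw [chartDeriv, e.right_inv hx]
    rfl
  exact hcoord ▸ hlinear

end Charts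

section LeftInvariantFields

variable {𝔤 : Type*} [AddCommGroup 𝔤] [Module ℝ 𝔤] [TopologicalSpace 𝔤]
  {G : Type*} [TopologicalSpace G] [ChartedSpace 𝔤 G] [Group G]

section Identity

variable [ContinuousAdd 𝔤] [ContinuousSMul ℝ 𝔤] [T2Space 𝔤]

theorem leftInvariantField_one (ξ : 𝔤) : leftInvariantField G ξ 1 = ξ := by
  have hone : (fun h : G => 1 * h) = id := funext one_mul
  change chartDeriv (chartAt 𝔤 1) (chartAt 𝔤 1) (fun h : G => 1 * h) 1 ξ = ξ
  rw [hone, chartDeriv_id_self (mem_chart_source 𝔤 1)]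

theorem fieldInChart_leftInvariantField_one (ξ : 𝔤) :
    fieldInChart ℝ (chartAt 𝔤 1) (leftInvariantField G ξ) (chartAt 𝔤 1 (1 : G)) = ξ := by
  rw [fieldInChart_apply (mem_chart_source 𝔤 1), chartDeriv_id_self (mem_chart_source 𝔤 1),
    leftInvariantField_one]

theorem localBracket_fieldInChart_leftInvariantField (ξ η : 𝔤) :
    localBracket (fieldInChart ℝ (chartAt 𝔤 1) (leftInvariantField G ξ))
      (fieldInChart ℝ (chartAt 𝔤 1) (leftInvariantField G η)) (chartAt 𝔤 1 (1 : G)) =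
      lieAlgBracket G ξ η := by
  rw [localBracket, lieAlgBracket, fieldBracket, fieldInChart_leftInvariantField_one,
    fieldInChart_leftInvariantField_one, leftInvariantField_one, leftInvariantField_one]

end Identity

namespace IsLCLieGroup

theorem isOpen_mulDomain (hG : IsLCLieGroup 𝔤 G) (e₁ e₂ e₃ : OpenPartialHomeomorph G 𝔤) :
    IsOpen {p : 𝔤 × 𝔤 | p.1 ∈ e₁.target ∧ p.2 ∈ e₂.target ∧
      e₁.symm p.1 * e₂.symm p.2 ∈ e₃.source} := by
  have hmul : ContinuousOn (fun p : 𝔤 × 𝔤 => e₁.symm p.1 * e₂.symm p.2)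
      (e₁.target ×ˢ e₂.target) :=
    hG.continuous_mul.comp_continuousOn (e₁.continuousOn_symm.prodMap e₂.continuousOn_symm)
  simpa only [inter_def, mem_prod, and_assoc, mem_preimage] using
    hmul.isOpen_inter_preimage (e₁.open_target.prod e₂.open_target) e₃.open_source

variable [IsTopologicalAddGroup 𝔤]

theorem lcSmooth_mul_left (hG : IsLCLieGroup 𝔤 G) (g : G) :
    LCSmooth ℝ 𝔤 𝔤 (fun h : G => g * h) := by
  refine ⟨hG.continuous_mul.comp (Continuous.prodMk_right g), fun e he e' he' => ?_⟩
  have hg := mem_chart_source 𝔤 g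
  have hslice := (hG.smooth_mul _ (chart_mem_atlas 𝔤 g) e he e' he').comp_const_add
    (ContinuousLinearMap.inr ℝ 𝔤 𝔤) (chartAt 𝔤 g g, 0)
  have hmul : MBSmoothOn ℝ (fun y => e' (g * e.symm y))
      {y | y ∈ e.target ∧ g * e.symm y ∈ e'.source} := by
    simpa [(chartAt 𝔤 g).left_inv hg, (chartAt 𝔤 g).map_source hg] using hslice
  exact hmul

variable [ContinuousSMul ℝ 𝔤] [LocallyConvexSpace ℝ 𝔤] [T2Space 𝔤]
  {e : OpenPartialHomeomorph G 𝔤} {g : G}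

theorem fieldInChart_leftInvariantField (hG : IsLCLieGroup 𝔤 G) (he : e ∈ atlas 𝔤 G)
    (hg : g ∈ e.source) (ξ : 𝔤) : fieldInChart ℝ e (leftInvariantField G ξ) (e g) =
      chartDeriv (chartAt 𝔤 1) e (fun h => g * h) 1 ξ := by
  rw [fieldInChart_apply hg]
  exact (hG.manifold.lcSmooth_id.chartDeriv_comp (hG.lcSmooth_mul_left g) (chart_mem_atlas 𝔤 1)
    (chart_mem_atlas 𝔤 g) he (mul_one g) (mem_chart_source 𝔤 1) (mem_chart_source 𝔤 g) hg ξ).symm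

theorem exists_hasDirDeriv_fieldInChart_leftInvariantField (hG : IsLCLieGroup 𝔤 G)
    (he : e ∈ atlas 𝔤 G) (hg : g ∈ e.source) (ξ v : 𝔤) :
    ∃ w, HasDirDeriv ℝ (fieldInChart ℝ e (leftInvariantField G ξ)) (e g) v w := by
  set φ := chartAt 𝔤 (1 : G)
  have hφ : φ.symm (φ 1) = 1 := φ.left_inv (mem_chart_source 𝔤 1)
  have hmul := (hG.smooth_mul e he φ (chart_mem_atlas 𝔤 1) e he).mbC2On
    (hG.isOpen_mulDomain e φ e)
  have hmem {x : 𝔤} (hx : x ∈ e.target) : (x, φ 1) ∈ {p : 𝔤 × 𝔤 | p.1 ∈ e.target ∧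
      p.2 ∈ φ.target ∧ e.symm p.1 * φ.symm p.2 ∈ e.source} :=
    ⟨hx, φ.map_source (mem_chart_source 𝔤 1), by simpa [hφ] using e.map_target hx⟩
  have hfield {x : 𝔤} (hx : x ∈ e.target) :
      dirDeriv ℝ (fun p : 𝔤 × 𝔤 => e (e.symm p.1 * φ.symm p.2)) (x, φ 1) (0, ξ) =
        fieldInChart ℝ e (leftInvariantField G ξ) x := by
    rw [← e.right_inv hx, hG.fieldInChart_leftInvariantField he (e.map_target hx), e.right_inv hx]
    exact ((hmul.hasDirDeriv _ (hmem hx) _).comp_line (c := fun y => (x, y))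
      fun t => by simp [φ]).dirDeriv_eq.symm
  have heg := e.map_source hg
  refine ⟨_, ((hmul.hasDirDeriv_dirDeriv (hmem heg) (0, ξ) (v, 0)).comp_line
    (c := fun x => (x, φ 1)) fun t => by simp).congr_of_eventuallyEq ?_ (hfield heg)⟩
  filter_upwards [(tendsto_add_smul_nhds (𝕜 := ℝ) (e g) v).eventually_mem
    (e.open_target.mem_nhds heg)] with t ht using hfield ht

end IsLCLieGroup

end LeftInvariantFields

section SymplecticActions

variable {E : Type*} [AddCommGroup E] [Module ℝ E] [TopologicalSpace E]
  {M : Type*} [TopologicalSpace M] [ChartedSpace E M]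
  {Ω : (m : M) → LCTangent E m →ₗ[ℝ] LCTangent E m →ₗ[ℝ] ℝ}

/-- Smooth closed 2-forms on a manifold, closedness being expressed in charts as for
`IsSymplecticForm`. -/
structure IsClosedTwoForm (Ω : (m : M) → LCTangent E m →ₗ[ℝ] LCTangent E m →ₗ[ℝ] ℝ) : Prop where
  alternating : ∀ m v, Ω m v v = 0
  smooth : ∀ e ∈ atlas E M,
    MBSmoothOn ℝ (fun p : E × E × E => formInChart (fun m u v => Ω m u v) e p.1 p.2.1 p.2.2)
      (e.target ×ˢ univ)
  closed : ∀ e ∈ atlas E M, ∀ x ∈ e.target, ∀ u v w : E,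
    dirDeriv ℝ (fun y => formInChart (fun m u v => Ω m u v) e y v w) x u
      + dirDeriv ℝ (fun y => formInChart (fun m u v => Ω m u v) e y w u) x v
      + dirDeriv ℝ (fun y => formInChart (fun m u v => Ω m u v) e y u v) x w = 0

theorem IsSymplecticForm.isClosedTwoForm (hΩ : IsSymplecticForm Ω) : IsClosedTwoForm Ω :=
  ⟨hΩ.alternating, hΩ.smooth, hΩ.closed⟩

variable [IsTopologicalAddGroup E] [ContinuousSMul ℝ E] [LocallyConvexSpace ℝ E] [T2Space E]

theorem IsClosedTwoForm.isClosedTwoFormOn_formInChart (hΩ : IsClosedTwoForm Ω)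
    (hM : IsLCManifold ℝ E M) {e : OpenPartialHomeomorph M E} (he : e ∈ atlas E M) :
    IsClosedTwoFormOn (formInChart (fun m u v => Ω m u v) e) e.target where
  mbC1On := (hΩ.smooth e he).mbC1On
  linear_left x hx v := ((Ω (e.symm x)).flip (tangentOfCoord ℝ e x v) ∘ₗ
    (hM.isLinearMap_tangentOfCoord he hx).mk').isLinear
  linear_right x hx u := (Ω (e.symm x) (tangentOfCoord ℝ e x u) ∘ₗ
    (hM.isLinearMap_tangentOfCoord he hx).mk').isLinear
  alternating x _ _ := hΩ.alternating (e.symm x) _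
  closed := hΩ.closed e he

variable {𝔤 : Type*} [AddCommGroup 𝔤] [Module ℝ 𝔤] [TopologicalSpace 𝔤] [IsTopologicalAddGroup 𝔤]
  [ContinuousSMul ℝ 𝔤]
  {G : Type*} [TopologicalSpace G] [ChartedSpace 𝔤 G] [Group G] [MulAction G M]

namespace IsSymplecticAction

/-- The linear map `ξ ↦ X_ξ(m)`, which is continuous because the orbit map of `m` is smooth. -/
noncomputable def fundamentalFieldCLM (hact : IsSymplecticAction 𝔤 G Ω) (m : M) : 𝔤 →L[ℝ] E :=
  (hact.smooth_orbitMap m).chartDerivCLM (chart_mem_atlas 𝔤 1) (chart_mem_atlas E m)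
    (mem_chart_source 𝔤 1) (by rw [one_smul]; exact mem_chart_source E m)

theorem lcTangentMap_fundamentalField (hact : IsSymplecticAction 𝔤 G Ω) (hG : IsLCLieGroup 𝔤 G)
    (g : G) (m : M) (ξ : 𝔤) :
    lcTangentMap (E := E) (F := E) ℝ (fun m' : M => g • m') rfl
      (fundamentalField (G := G) ξ m) =
      chartDeriv (chartAt 𝔤 g) (chartAt E (g • m)) (fun h => h • m) g
        (leftInvariantField G ξ g) := by
  have horbit := (hact.smooth_orbitMap m).chartDeriv_comp (hG.lcSmooth_mul_left g)
    (chart_mem_atlas 𝔤 1) (chart_mem_atlas 𝔤 g) (chart_mem_atlas E (g • m)) (mul_one g)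
    (mem_chart_source 𝔤 1) (mem_chart_source 𝔤 g) (mem_chart_source E (g • m)) ξ
  have haction := (hact.smooth_smul g).chartDeriv_comp (hact.smooth_orbitMap m)
    (chart_mem_atlas 𝔤 1) (chart_mem_atlas E m) (chart_mem_atlas E (g • m)) (one_smul G m)
    (mem_chart_source 𝔤 1) (mem_chart_source E m) (mem_chart_source E (g • m)) ξ
  simp only [mul_smul] at horbit
  exact haction.symm.trans horbit

theorem pullbackForm_inCharts_orbitMap (hact : IsSymplecticAction 𝔤 G Ω) (hG : IsLCLieGroup 𝔤 G)
    (hM : IsLCManifold ℝ E M) {e : OpenPartialHomeomorph G 𝔤} (he : e ∈ atlas 𝔤 G)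
    {e' : OpenPartialHomeomorph M E} (he' : e' ∈ atlas E M) (m : M) {x : 𝔤}
    (hx : x ∈ inChartsDomain e e' fun g : G => g • m) (ξ η : 𝔤) :
    pullbackForm (inCharts e e' fun g : G => g • m) (formInChart (fun m u v => Ω m u v) e') x
      (fieldInChart ℝ e (leftInvariantField G ξ) x)
      (fieldInChart ℝ e (leftInvariantField G η) x) = kostantSouriau G Ω m ξ η := by
  obtain ⟨g, hg, rfl⟩ : ∃ g ∈ e.source, e g = x := ⟨_, e.map_target hx.1, e.right_inv hx.1⟩
  have hgm : g • m ∈ e'.source := by simpa only [mem_preimage, e.left_inv hg] using hx.2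
  have htangent (ξ : 𝔤) : chartDeriv e' (chartAt E (g • m)) id (g • m)
      (chartDeriv e e' (fun h => h • m) g (fieldInChart ℝ e (leftInvariantField G ξ) (e g))) =
        lcTangentMap (E := E) (F := E) ℝ (fun m' : M => g • m') rfl
      (fundamentalField (G := G) ξ m) := by
    rw [hact.lcTangentMap_fundamentalField hG, fieldInChart_apply hg,
      ← hM.lcSmooth_id.chartDeriv_comp (hact.smooth_orbitMap m) he he'
        (chart_mem_atlas E (g • m)) rfl hg hgm (mem_chart_source E (g • m))]
    exact ((hact.smooth_orbitMap m).chartDeriv_comp hG.manifold.lcSmooth_id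
      (chart_mem_atlas 𝔤 g) he (chart_mem_atlas E (g • m)) rfl (mem_chart_source 𝔤 g) hg
      (mem_chart_source E (g • m)) _).symm
  rw [pullbackForm, inCharts_apply hg, formInChart_apply _ hgm]
  refine Eq.trans ?_ (hact.preserves g m _ _)
  exact congrArg₂ (fun u v => Ω (g • m) u v) (htangent ξ) (htangent η)

variable [LocallyConvexSpace ℝ 𝔤] [T2Space 𝔤]

theorem kostantSouriau_cocycle (hact : IsSymplecticAction 𝔤 G Ω) (hG : IsLCLieGroup 𝔤 G)
    (hM : IsLCManifold ℝ E M) (hΩ : IsClosedTwoForm Ω) (m : M) (ξ η ζ : 𝔤) :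
    kostantSouriau G Ω m (lieAlgBracket G ξ η) ζ + kostantSouriau G Ω m (lieAlgBracket G η ζ) ξ
      + kostantSouriau G Ω m (lieAlgBracket G ζ ξ) η = 0 := by
  set e := chartAt 𝔤 (1 : G)
  set e' := chartAt E m
  set U := inChartsDomain e e' fun g : G => g • m
  set B := pullbackForm (inCharts e e' fun g : G => g • m) (formInChart (fun m u v => Ω m u v) e')
  have he : e ∈ atlas 𝔤 G := chart_mem_atlas 𝔤 1
  have he' : e' ∈ atlas E M := chart_mem_atlas E m
  have hone : (1 : G) ∈ e.source := mem_chart_source 𝔤 1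
  have hU : IsOpen U := isOpen_inChartsDomain e e' (hact.smooth_orbitMap m).1
  have hmem : e 1 ∈ U :=
    mem_inChartsDomain hone (by rw [one_smul]; exact mem_chart_source E m)
  have hB : IsClosedTwoFormOn B U :=
    (hΩ.isClosedTwoFormOn_formInChart hM he').pullback e'.open_target
      (((hact.smooth_orbitMap m).mbSmoothOn_inCharts he he').mbC2On hU) hU
      fun x hx => e'.map_source hx.2
  have hvalue {x : 𝔤} (hx : x ∈ U) (ξ η : 𝔤) :
      B x (fieldInChart ℝ e (leftInvariantField G ξ) x)
        (fieldInChart ℝ e (leftInvariantField G η) x) = kostantSouriau G Ω m ξ η :=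
    hact.pullbackForm_inCharts_orbitMap hG hM he he' m hx ξ η
  have hvalue_one (u v : 𝔤) : B (e 1) u v = kostantSouriau G Ω m u v := by
    simpa only [e, fieldInChart_leftInvariantField_one] using hvalue hmem u v
  have hdiff (ξ : 𝔤) := hG.exists_hasDirDeriv_fieldInChart_leftInvariantField he hone ξ
  have hconst (ξ η : 𝔤) (y : 𝔤) (hy : y ∈ U) := (hvalue hy ξ η).trans (hvalue hmem ξ η).symm
  have hcocycle := hB.cocycle_of_const hU hmem (hdiff ξ) (hdiff η) (hdiff ζ) (hconst ξ η)
    (hconst η ζ) (hconst ζ ξ)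
  simpa only [e, localBracket_fieldInChart_leftInvariantField,
    fieldInChart_leftInvariantField_one, hvalue_one] using hcocycle

theorem isContinuousTwoCocycle_kostantSouriau (hact : IsSymplecticAction 𝔤 G Ω)
    (hG : IsLCLieGroup 𝔤 G) (hM : IsLCManifold ℝ E M) (hΩ : IsClosedTwoForm Ω) (m : M) :
    IsContinuousTwoCocycle (lieAlgBracket (𝔤 := 𝔤) G) (kostantSouriau (𝔤 := 𝔤) G Ω m) where
  linear_left η := ((Ω m).flip (fundamentalField η m) ∘ₗ
    (hact.fundamentalFieldCLM m).toLinearMap).isLinear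
  linear_right ξ := (Ω m (fundamentalField ξ m) ∘ₗ
    (hact.fundamentalFieldCLM m).toLinearMap).isLinear
  alternating _ := hΩ.alternating m _
  continuous := (continuous_of_continuousOn_formInChart m
    (hΩ.smooth _ (chart_mem_atlas E m)).mbC1On.continuousOn).comp
      ((hact.fundamentalFieldCLM m).continuous.prodMap (hact.fundamentalFieldCLM m).continuous)
  cocycle := hact.kostantSouriau_cocycle hG hM hΩ m

end IsSymplecticAction

end SymplecticActions

section HermitianForms

namespace Complexified

variable {V W : Type*} [AddCommGroup V] [Module ℝ V] [AddCommGroup W] [Module ℝ W] [Module ℂ W]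
  [IsScalarTower ℝ ℂ W]

/-- The complex linear extension to the complexification of a real linear map into a complex vector
space. -/
noncomputable def lift (A : V →ₗ[ℝ] W) : Complexified V →ₗ[ℂ] W where
  toFun a := A a.1 + Complex.I • A a.2
  map_add' a b := by
    change A (a.1 + b.1) + Complex.I • A (a.2 + b.2) = _
    rw [map_add, map_add]
    module
  map_smul' z a := by
    change A (z.re • a.1 - z.im • a.2) + Complex.I • A (z.re • a.2 + z.im • a.1) = _
    simp only [map_sub, map_add, map_smul, ← algebraMap_smul ℂ (_ : ℝ) (_ : W), RingHom.id_apply]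
    match_scalars <;> simp only [Complex.coe_algebraMap]
    · linear_combination Complex.re_add_im z
    · linear_combination Complex.I * Complex.re_add_im z - (z.im : ℂ) * Complex.I_sq

theorem lift_ofReal (A : V →ₗ[ℝ] W) (v : V) : lift A (ofReal v) = A v := by
  change A v + Complex.I • A 0 = A v
  rw [map_zero, smul_zero, add_zero]

theorem continuous_lift [TopologicalSpace V] [TopologicalSpace W] [ContinuousAdd W]
    [ContinuousConstSMul ℂ W] {A : V →ₗ[ℝ] W} (hA : Continuous A) : Continuous (lift A) := by
  have hsum : Continuous fun a : V × V => A a.1 + Complex.I • A a.2 := by fun_prop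
  exact hsum

theorem exists_hermitian_pullback [TopologicalSpace V] [TopologicalSpace W] [ContinuousAdd W]
    [ContinuousConstSMul ℂ W] {A : V →ₗ[ℝ] W} (hA : Continuous A) {H : W →ₗ⋆[ℂ] W →ₗ[ℂ] ℂ}
    (hcont : Continuous fun p : W × W => H p.1 p.2) (hconj : ∀ u v, H v u = conj (H u v))
    (hpos : ∀ u, 0 ≤ (H u u).re) :
    ∃ h : Complexified V →ₗ⋆[ℂ] Complexified V →ₗ[ℂ] ℂ,
      Continuous (fun p : Complexified V × Complexified V => h p.1 p.2) ∧
      (∀ a b, h b a = conj (h a b)) ∧ (∀ a, 0 ≤ (h a a).re) ∧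
      ∀ v w, h (ofReal v) (ofReal w) = H (A v) (A w) := by
  have hlift := continuous_lift hA
  let h : Complexified V →ₗ⋆[ℂ] Complexified V →ₗ[ℂ] ℂ := (H.comp (lift A)).compl₂ (lift A)
  have hh (a b : Complexified V) : h a b = H (lift A a) (lift A b) := rfl
  refine ⟨h, hcont.comp (hlift.prodMap hlift), fun a b => hconj _ _, fun a => hpos _,
    fun v w => ?_⟩
  rw [hh, lift_ofReal, lift_ofReal]

end Complexified

theorem IsKahler.exists_hermitian {E : Type*} [AddCommGroup E] [Module ℝ E] [Module ℂ E]
    [TopologicalSpace E] [ContinuousAdd E] [ContinuousSMul ℝ E] [T2Space E]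
    {M : Type*} [TopologicalSpace M] [ChartedSpace E M]
    {Ω : (m : M) → LCTangent E m →ₗ[ℝ] LCTangent E m →ₗ[ℝ] ℝ} (hΩ : IsKahler Ω) (m : M) :
    ∃ H : E →ₗ⋆[ℂ] E →ₗ[ℂ] ℂ, Continuous (fun p : E × E => H p.1 p.2) ∧
      (∀ u v, H v u = conj (H u v)) ∧ (∀ u, 0 ≤ (H u u).re) ∧
      ∀ u v, Ω m u v = (H u v).im := by
  obtain ⟨-, -, H, hsmooth, hconj, hpos, him⟩ := hΩ
  refine ⟨H m, continuous_of_continuousOn_formInChart m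
    (hsmooth _ (chart_mem_atlas E m)).mbC1On.continuousOn, hconj m, fun u => ?_, him m⟩
  rcases eq_or_ne u 0 with rfl | hu
  · simp
  · exact (hpos m u hu).le

end HermitianForms

theorem mainTheorem9_general
    {𝔤 : Type*} [AddCommGroup 𝔤] [Module ℝ 𝔤] [TopologicalSpace 𝔤] [IsTopologicalAddGroup 𝔤]
    [ContinuousSMul ℝ 𝔤] [LocallyConvexSpace ℝ 𝔤] [T2Space 𝔤]
    {E : Type*} [AddCommGroup E] [Module ℝ E] [TopologicalSpace E] [IsTopologicalAddGroup E]
    [ContinuousSMul ℝ E] [LocallyConvexSpace ℝ E] [T2Space E]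
    {G : Type*} [TopologicalSpace G] [ChartedSpace 𝔤 G] [Group G]
    {M : Type*} [TopologicalSpace M] [ChartedSpace E M] [MulAction G M]
    (hG : IsLCLieGroup 𝔤 G)
    (hM : IsLCManifold ℝ E M)
    (Ω : (m : M) → LCTangent E m →ₗ[ℝ] LCTangent E m →ₗ[ℝ] ℝ)
    (hΩ : IsClosedTwoForm Ω)
    (hact : IsSymplecticAction 𝔤 G Ω)
    (m : M) :
    IsContinuousTwoCocycle (lieAlgBracket (𝔤 := 𝔤) G) (kostantSouriau (𝔤 := 𝔤) G Ω m) ∧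
    ∀ [Module ℂ E] [IsScalarTower ℝ ℂ E] [ContinuousSMul ℂ E],
      (∃ H : E →ₗ⋆[ℂ] E →ₗ[ℂ] ℂ,
        Continuous (fun p : E × E => H p.1 p.2) ∧
        (∀ u v, H v u = conj (H u v)) ∧
        (∀ u, 0 ≤ (H u u).re) ∧
        (∀ u v, Ω m u v = (H u v).im)) →
      ∃ h : Complexified 𝔤 →ₗ⋆[ℂ] Complexified 𝔤 →ₗ[ℂ] ℂ,
        Continuous (fun p : Complexified 𝔤 × Complexified 𝔤 => h p.1 p.2) ∧
        (∀ a b, h b a = conj (h a b)) ∧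
        (∀ a, 0 ≤ (h a a).re) ∧
        (∀ ξ η : 𝔤, kostantSouriau (𝔤 := 𝔤) G Ω m ξ η =
          (h (Complexified.ofReal ξ) (Complexified.ofReal η)).im) := by
  refine ⟨hact.isContinuousTwoCocycle_kostantSouriau hG hM hΩ m, ?_⟩
  rintro _ _ _ ⟨H, hcont, hconj, hpos, him⟩
  obtain ⟨h, hh_cont, hh_conj, hh_pos, hh⟩ :=
    Complexified.exists_hermitian_pullback (hact.fundamentalFieldCLM m).continuous hcont hconj hpos
  refine ⟨h, hh_cont, hh_conj, hh_pos, fun ξ η => ?_⟩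
  rw [hh]
  exact him _ _

theorem mainTheorem9
    {𝔤 : Type*} [AddCommGroup 𝔤] [Module ℝ 𝔤] [TopologicalSpace 𝔤] [IsTopologicalAddGroup 𝔤]
    [ContinuousSMul ℝ 𝔤] [LocallyConvexSpace ℝ 𝔤] [T2Space 𝔤]
    {E : Type*} [AddCommGroup E] [Module ℝ E] [TopologicalSpace E] [IsTopologicalAddGroup E]
    [ContinuousSMul ℝ E] [LocallyConvexSpace ℝ E] [T2Space E]
    {G : Type*} [TopologicalSpace G] [ChartedSpace 𝔤 G] [Group G]
    {M : Type*} [TopologicalSpace M] [ChartedSpace E M] [MulAction G M]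
    (hG : IsLCLieGroup 𝔤 G)
    (hM : IsLCManifold ℝ E M)
    (Ω : (m : M) → LCTangent E m →ₗ[ℝ] LCTangent E m →ₗ[ℝ] ℝ)
    (hΩ : IsSymplecticForm Ω)
    (hact : IsSymplecticAction 𝔤 G Ω)
    (m : M) :
    IsContinuousTwoCocycle (lieAlgBracket (𝔤 := 𝔤) G) (kostantSouriau (𝔤 := 𝔤) G Ω m) ∧
    ∀ [Module ℂ E] [IsScalarTower ℝ ℂ E] [ContinuousSMul ℂ E],
      IsKahler Ω →
      ∃ h : Complexified 𝔤 →ₗ⋆[ℂ] Complexified 𝔤 →ₗ[ℂ] ℂ,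
        Continuous (fun p : Complexified 𝔤 × Complexified 𝔤 => h p.1 p.2) ∧
        (∀ a b, h b a = conj (h a b)) ∧
        (∀ a, 0 ≤ (h a a).re) ∧
        (∀ ξ η : 𝔤, kostantSouriau (𝔤 := 𝔤) G Ω m ξ η =
          (h (Complexified.ofReal ξ) (Complexified.ofReal η)).im) := by
  obtain ⟨hcocycle, hhermitian⟩ := mainTheorem9_general hG hM Ω hΩ.isClosedTwoForm hact m
  exact ⟨hcocycle, fun hK => hhermitian (hK.exists_hermitian m)⟩
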